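/- For $n\ge 1$ let $PG_n$ denote the pancake graph: its vertices are the $n!$ permutations $a_1a_2\ldots a_n$ of $\{1,2,\ldots,n\}$, and two vertices $a_1\ldots a_n$ and $b_1\ldots b_n$ are adjacent if there is an integer $k$ with $2\le k\le n$ such that $a_i=b_{k+1-i}$ for $1\le i\le k$ and $a_i=b_i$ for $k+1\le i\le n$. A fractional perfect matching of a finite simple graph $G$ is a function $f:E(G)\to[0,1]$ such that $\sum_{e\ni v}f(e)=1$ for every vertex $v$ of $G$, the sum being over the edges $e$ of $G$ incident with $v$. Let $\mathrm{fmp}(G)$ be the minimum size of a set $F\subseteq E(G)$ such that $G-F$ has no fractional perfect matching, and let $\mathrm{fsmp}(G)$ be the minimum size of a set $F\subseteq V(G)\cup E(G)$ such that $G-F$ has no fractional perfect matching. **Theorem.** For every integer $n\ge 4$, $\mathrm{fsmp}(PG_n)=\mathrm{fmp}(PG_n)=n-1$. -/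

import Mathlib

/-- The pancake graph of dimension `n`. A vertex is a permutation `a`, read as the word
`a 0, a 1, …, a (n - 1)` (positions and symbols are numbered from `0`). Two words are adjacent
when one arises from the other by reversing a prefix of some length `k` with `2 ≤ k ≤ n`:
position `i < k` of one word carries the symbol at position `k - 1 - i` of the other. -/
def pancakeGraph (n : ℕ) : SimpleGraph (Equiv.Perm (Fin n)) where
  Adj a b := ∃ k : ℕ, 2 ≤ k ∧ k ≤ n ∧
    (∀ i j : Fin n, (i : ℕ) + (j : ℕ) + 1 = k → a i = b j) ∧
    (∀ i : Fin n, k ≤ (i : ℕ) → a i = b i)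
  symm := ⟨fun a b ⟨k, h2, hn, hrev, hfix⟩ =>
    ⟨k, h2, hn, fun i j hij => (hrev j i (by omega)).symm, fun i hi => (hfix i hi).symm⟩⟩
  loopless := ⟨fun a ⟨k, h2, hn, hrev, _⟩ => by
    have h := a.injective (hrev ⟨0, by omega⟩ ⟨k - 1, by omega⟩ (by simp; omega))
    have h' := congrArg Fin.val h
    simp at h'
    omega⟩

namespace SimpleGraph

open Classical in
/-- `f` is a fractional perfect matching of `G`: it assigns to each edge a number in `[0, 1]` such
that the values on the edges incident with any vertex sum to `1`. (Values of `f` on pairs that are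
not edges of `G` play no role.) -/
def IsFractionalPerfectMatching {V : Type*} [Fintype V] (G : SimpleGraph V)
    (f : Sym2 V → ℝ) : Prop :=
  (∀ e ∈ G.edgeSet, 0 ≤ f e ∧ f e ≤ 1) ∧ ∀ v : V, ∑ e ∈ G.incidenceFinset v, f e = 1

/-- `G` has a fractional perfect matching. -/
def HasFractionalPerfectMatching {V : Type*} [Fintype V] (G : SimpleGraph V) : Prop :=
  ∃ f : Sym2 V → ℝ, G.IsFractionalPerfectMatching f

/-- An FMP set: a set `F` of edges of `G` such that `G - F` has no fractional perfect matching. -/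
def IsFMPSet {V : Type*} [Fintype V] (G : SimpleGraph V) (F : Finset (Sym2 V)) : Prop :=
  (F : Set (Sym2 V)) ⊆ G.edgeSet ∧
    ¬ (G.deleteEdges (F : Set (Sym2 V))).HasFractionalPerfectMatching

open Classical in
/-- An FSMP set, given by its set `FV` of vertices and its set `FE` of edges of `G`: deleting the
edges in `FE` and the vertices in `FV` leaves a graph with no fractional perfect matching. -/
def IsFSMPSet {V : Type*} [Fintype V] (G : SimpleGraph V)
    (FV : Finset V) (FE : Finset (Sym2 V)) : Prop :=
  (FE : Set (Sym2 V)) ⊆ G.edgeSet ∧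
    ¬ ((G.deleteEdges (FE : Set (Sym2 V))).induce {v : V | v ∉ FV}).HasFractionalPerfectMatching

/-- The FMP number: the minimum size of an FMP set. -/
noncomputable def fmp {V : Type*} [Fintype V] (G : SimpleGraph V) : ℕ :=
  sInf {m : ℕ | ∃ F : Finset (Sym2 V), G.IsFMPSet F ∧ F.card = m}

/-- The FSMP number: the minimum size (vertices plus edges) of an FSMP set. -/
noncomputable def fsmp {V : Type*} [Fintype V] (G : SimpleGraph V) : ℕ :=
  sInf {m : ℕ | ∃ (FV : Finset V) (FE : Finset (Sym2 V)),
    G.IsFSMPSet FV FE ∧ FV.card + FE.card = m}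

end SimpleGraph

/-! Deleting the at most `n - 1` edges at one vertex isolates it, which gives the upper bounds. The
lower bounds follow once any `n - 2` vertex and edge faults leave a fractional perfect matching.

This is proved by induction on `m` for suffix classes, which are copies of the pancake graph of
dimension `m`, against `m - 2` faults (`FaultTolerant`). A class of level `m + 1` splits into
subclasses by the symbol at position `m`. If no subclass holds more than `m - 2` faults, the pieces
are glued (`FaultTolerant.union`). Otherwise one subclass holds all `m - 1` faults. One of them is
forgiven, the induction hypothesis is applied, and the weight on the forgiven fault is removed. The
vertices left short are served by edges into other subclasses (`FaultTolerant.reroute`), averaged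
with the removed weights as coefficients. Arbitrary vertex demands in `HasFractionalFactor` make
these deficits and averages expressible.

The base case `m = 4` is a finite check on 24 words, by explicit tables. -/

open Finset

/-! ### Fractional factors with prescribed vertex demands -/

namespace SimpleGraph

variable {V : Type*} [Fintype V]

/-- `H` carries nonnegative symmetric edge weights whose sum at each vertex `v` is `d v`. -/
def HasFractionalFactor (H : SimpleGraph V) (d : V → ℝ) : Prop :=
  ∃ w : V → V → ℝ, (∀ u v, w u v = w v u) ∧ (∀ u v, 0 ≤ w u v) ∧
    (∀ u v, w u v ≠ 0 → H.Adj u v) ∧ ∀ u, ∑ v, w u v = d u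

namespace HasFractionalFactor

variable {H : SimpleGraph V} {d d' : V → ℝ}

theorem zero (H : SimpleGraph V) : H.HasFractionalFactor 0 :=
  ⟨fun _ _ => 0, by simp, by simp, by simp, by simp⟩

theorem add (h : H.HasFractionalFactor d) (h' : H.HasFractionalFactor d') :
    H.HasFractionalFactor (d + d') := by
  obtain ⟨w, hs, hp, ha, hd⟩ := h
  obtain ⟨w', hs', hp', ha', hd'⟩ := h'
  refine ⟨fun u v => w u v + w' u v, fun u v => by simp only [hs u v, hs' u v],
    fun u v => add_nonneg (hp u v) (hp' u v), fun u v huv => ?_, fun u => ?_⟩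
  · by_cases h0 : w u v = 0
    · exact ha' u v fun h1 => huv (by simp [h0, h1])
    · exact ha u v h0
  · simp [sum_add_distrib, hd, hd']

/-- The factor is required only for `c ≠ 0`, so terms of weight zero in a combination need no
witness. -/
theorem smul {c : ℝ} (hc : 0 ≤ c) (h : c ≠ 0 → H.HasFractionalFactor d) :
    H.HasFractionalFactor (c • d) := by
  by_cases h0 : c = 0
  · rw [h0, zero_smul]; exact zero H
  obtain ⟨w, hs, hp, ha, hd⟩ := h h0
  refine ⟨fun u v => c * w u v, fun u v => by simp only [hs u v], fun u v => mul_nonneg hc (hp u v),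
    fun u v huv => ha u v (right_ne_zero_of_mul huv), fun u => ?_⟩
  simp [← mul_sum, hd]

theorem sum {ι : Type*} (s : Finset ι) {D : ι → V → ℝ}
    (h : ∀ i ∈ s, H.HasFractionalFactor (D i)) : H.HasFractionalFactor (∑ i ∈ s, D i) :=
  Finset.sum_induction D H.HasFractionalFactor (fun _ _ => add) (zero H) h

theorem edge [DecidableEq V] {u v : V} (huv : H.Adj u v) :
    H.HasFractionalFactor (Pi.single u 1 + Pi.single v 1) := by
  have hne := huv.ne
  refine ⟨fun x y => if (x = u ∧ y = v) ∨ (x = v ∧ y = u) then 1 else 0, fun x y => ?_,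
    fun x y => ?_, fun x y hxy => ?_, fun x => ?_⟩
  · dsimp only
    congr 1
    simp only [eq_iff_iff]
    tauto
  · dsimp only
    split_ifs <;> simp
  · simp only [ne_eq, ite_eq_right_iff, one_ne_zero, imp_false, not_not] at hxy
    rcases hxy with ⟨rfl, rfl⟩ | ⟨rfl, rfl⟩
    exacts [huv, huv.symm]
  · by_cases hx : x = u
    · subst hx; simp [hne]
    · by_cases hx' : x = v
      · subst hx'; simp [hne.symm]
      · simp [hx, hx']

/-- Here `t` is the weight on the edge; setting it to zero costs each end exactly `t`. -/
theorem delete_edge [DecidableEq V] (h : H.HasFractionalFactor d) (u v : V) :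
    ∃ t : ℝ, 0 ≤ t ∧ t ≤ d u ∧ t ≤ d v ∧ (t ≠ 0 → H.Adj u v) ∧
      (H.deleteEdges {s(u, v)}).HasFractionalFactor
        (d - t • (Pi.single u 1 + Pi.single v 1)) := by
  obtain ⟨w, hs, hp, ha, hd⟩ := h
  have hle : ∀ x y, w x y ≤ d x := fun x y =>
    hd x ▸ single_le_sum (fun z _ => hp x z) (mem_univ y)
  refine ⟨w u v, hp u v, hle u v, hs u v ▸ hle v u, ha u v,
    fun x y => if s(x, y) = s(u, v) then 0 else w x y, fun x y => ?_, fun x y => ?_,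
    fun x y hxy => ?_, fun x => ?_⟩
  · simp only [hs x y, Sym2.eq_swap]
  · dsimp only; split_ifs
    exacts [le_rfl, hp x y]
  · dsimp only at hxy
    split_ifs at hxy with h1
    · exact absurd rfl hxy
    · simp [deleteEdges_adj, ha x y hxy, h1]
  · have key : ∀ y, (if s(x, y) = s(u, v) then 0 else w x y) =
        w x y - (if s(x, y) = s(u, v) then w x y else 0) := fun y => by split_ifs <;> simp
    simp only [key, sum_sub_distrib, hd, Pi.sub_apply, Pi.smul_apply, Pi.add_apply, smul_eq_mul]
    congr 1
    by_cases huv : u = v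
    · subst huv
      have h0 : w u u = 0 := by
        by_contra h0
        exact (ha u u h0).ne rfl
      rw [h0, zero_mul]
      refine sum_eq_zero fun y _ => ?_
      split_ifs with h1
      · simp only [Sym2.eq_iff, or_self] at h1
        rw [h1.1, h1.2, h0]
      · rfl
    by_cases hx : x = u
    · subst hx
      simp [Ne.symm, huv]
    · by_cases hx' : x = v
      · subst hx'
        simp [hs u x, hx]
      · simp [hx, hx']

/-- Here `t x` is the weight on the edge from `u` to `x`; discarding these weights leaves `u` with
demand zero and `x` short by `t x`. -/
theorem delete_vertex [DecidableEq V] (h : H.HasFractionalFactor d) (u : V) :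
    ∃ t : V → ℝ, (∀ x, 0 ≤ t x) ∧ (∀ x, t x ≤ d x) ∧ (∀ x, t x ≠ 0 → H.Adj u x) ∧
      ∑ x, t x = d u ∧ H.HasFractionalFactor (d - Pi.single u (d u) - t) := by
  obtain ⟨w, hs, hp, ha, hd⟩ := h
  have hle : ∀ x y, w x y ≤ d x := fun x y =>
    hd x ▸ single_le_sum (fun z _ => hp x z) (mem_univ y)
  have h0 : w u u = 0 := by
    by_contra h0
    exact (ha u u h0).ne rfl
  refine ⟨w u, hp u, fun x => hs u x ▸ hle x u, ha u, hd u,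
    fun x y => if x = u ∨ y = u then 0 else w x y, fun x y => ?_, fun x y => ?_,
    fun x y hxy => ?_, fun x => ?_⟩
  · simp only [hs x y, or_comm]
  · dsimp only; split_ifs
    exacts [le_rfl, hp x y]
  · dsimp only at hxy
    split_ifs at hxy with h1
    · exact absurd rfl hxy
    · exact ha x y hxy
  · by_cases hx : x = u
    · subst hx; simp [h0]
    · have key : ∀ y, (if x = u ∨ y = u then 0 else w x y) =
          w x y - (if y = u then w x y else 0) := fun y => by
        simp only [hx, false_or]; split_ifs <;> simp
      simp only [key, sum_sub_distrib, hd]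
      simp [hx, hs u x]

/-- A permutation moving every vertex of a set along an edge yields a fractional factor. -/
theorem of_permutation {ι : Type*} {φ : ι → V} (hφ : Function.Injective φ) (S : Finset ι)
    {p : ι → ι} (hp : Set.MapsTo p S S) (hinj : Set.InjOn p S)
    (hadj : ∀ i ∈ S, H.Adj (φ i) (φ (p i))) :
    H.HasFractionalFactor ((φ '' S).indicator 1) := by
  classical
  -- Each vertex receives one half as a source and one half as a target, so odd cycles of `p` are
  -- allowed.
  have h := sum S fun i hi => smul (by norm_num : (0 : ℝ) ≤ 1 / 2) fun _ => edge (hadj i hi)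
  have himg : S.image p = S :=
    eq_of_subset_of_card_le (fun y hy => by
      obtain ⟨x, hx, rfl⟩ := mem_image.1 hy
      exact hp hx) (card_image_of_injOn hinj).ge
  have hre : ∑ i ∈ S, (Pi.single (φ (p i)) 1 : V → ℝ) = ∑ i ∈ S, Pi.single (φ i) 1 := by
    conv_rhs => rw [← himg]
    rw [sum_image hinj]
  convert h using 1
  rw [← smul_sum, sum_add_distrib, hre, ← two_smul ℝ, smul_smul]
  norm_num
  ext x
  rw [Finset.sum_apply]
  by_cases hx : x ∈ φ '' S
  · obtain ⟨i, hi, rfl⟩ := hx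
    have hi' : i ∈ S := hi
    simp [Pi.single_apply, hφ.eq_iff, hi']
  · rw [Set.indicator_of_notMem hx, eq_comm]
    refine sum_eq_zero fun i hi => ?_
    rw [Pi.single_apply, if_neg]
    rintro rfl
    exact hx ⟨i, hi, rfl⟩

open Classical in
theorem hasFractionalPerfectMatching (h : H.HasFractionalFactor 1) :
    H.HasFractionalPerfectMatching := by
  obtain ⟨w, hs, hp, ha, hd⟩ := h
  refine ⟨Sym2.lift ⟨w, hs⟩, fun e => ?_, fun v => ?_⟩
  · induction e with
    | _ u v =>
      intro _
      refine ⟨hp u v, ?_⟩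
      have := single_le_sum (fun z _ => hp u z) (mem_univ v)
      rw [hd] at this
      exact this
  · have himg : H.incidenceFinset v = (H.neighborFinset v).image fun x => s(v, x) := by
      ext e
      induction e with
      | _ x y =>
        simp only [mem_incidenceFinset, mem_image, mem_neighborFinset, mk'_mem_incidenceSet_iff,
          Sym2.eq_iff]
        constructor
        · rintro ⟨h1, rfl | rfl⟩
          exacts [⟨y, h1, by simp⟩, ⟨x, h1.symm, by simp⟩]
        · rintro ⟨z, hz, ⟨rfl, rfl⟩ | ⟨rfl, rfl⟩⟩
          exacts [⟨hz, by simp⟩, ⟨hz.symm, by simp⟩]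
    rw [himg, sum_image (fun x _ y _ hxy => Sym2.congr_right.1 hxy)]
    simp only [Sym2.lift_mk]
    rw [← Pi.one_apply (M := fun _ : V => ℝ) v, ← hd v]
    refine sum_subset (subset_univ _) fun x _ hx => ?_
    by_contra h0
    exact hx ((mem_neighborFinset _ _ _).2 (ha v x h0))

/-- Demand zero outside `S` forces every edge leaving `S` to have weight zero. -/
theorem induce {S : Set V} [Fintype S] (h : H.HasFractionalFactor (S.indicator 1)) :
    (H.induce S).HasFractionalFactor 1 := by
  classical
  obtain ⟨w, hs, hp, ha, hd⟩ := h
  refine ⟨fun x y => w x y, fun _ _ => hs _ _, fun _ _ => hp _ _, fun x y hxy => ha x y hxy,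
    fun x => ?_⟩
  have h1 := hd x
  rw [Set.indicator_of_mem x.2] at h1
  rw [Pi.one_apply, ← Pi.one_apply (M := fun _ : V => ℝ) (x : V), ← h1]
  have hz : ∀ y, y ∉ S → w x y = 0 := fun y hy => by
    have h2 := hd y
    rw [Set.indicator_of_notMem hy] at h2
    rw [hs]
    exact (sum_eq_zero_iff_of_nonneg fun z _ => hp y z).1 h2 _ (mem_univ _)
  rw [← sum_filter_of_ne (p := (· ∈ S)) fun y _ hy => by_contra fun h => hy (hz y h)]
  exact (sum_subtype _ (by simp) fun y => w x y).symm

end HasFractionalFactor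

end SimpleGraph

/-! ### Suffix classes and the inductive step -/

namespace Pancake

open SimpleGraph

variable {n : ℕ}

/-- Reversal of the first `k` positions (the identity if `n < k`). -/
def prefixRev (n k : ℕ) : Equiv.Perm (Fin n) :=
  Function.Involutive.toPerm
    (fun i => if h : (i : ℕ) < k ∧ k ≤ n then ⟨k - 1 - i, by omega⟩ else i) fun i => by
      by_cases h : (i : ℕ) < k ∧ k ≤ n
      · have h' : k - 1 - (i : ℕ) < k ∧ k ≤ n := by omega
        simp only [h, and_self, dif_pos, h']
        ext
        simp only
        omega
      · simp only [h, dif_neg, not_false_eq_true]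

theorem prefixRev_val_of_lt {k : ℕ} (hk : k ≤ n) {i : Fin n} (hi : (i : ℕ) < k) :
    (prefixRev n k i : ℕ) = k - 1 - i := by
  simp [prefixRev, hi, hk]

theorem prefixRev_of_le {k : ℕ} {i : Fin n} (hi : k ≤ (i : ℕ)) : prefixRev n k i = i := by
  change dite _ _ _ = _
  rw [dif_neg (by omega)]

theorem prefixRev_mul_self (n k : ℕ) : prefixRev n k * prefixRev n k = 1 :=
  Equiv.ext (Function.Involutive.toPerm_involutive _)

theorem adj_mul_prefixRev {k : ℕ} (hk : 2 ≤ k) (hkn : k ≤ n) (a : Equiv.Perm (Fin n)) :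
    (pancakeGraph n).Adj a (a * prefixRev n k) := by
  refine ⟨k, hk, hkn, fun i j hij => ?_, fun i hi => ?_⟩
  · rw [Equiv.Perm.mul_apply]
    congr 1
    ext
    rw [prefixRev_val_of_lt hkn (by omega)]
    omega
  · rw [Equiv.Perm.mul_apply, prefixRev_of_le hi]

theorem mul_prefixRev_of_adj {a b : Equiv.Perm (Fin n)} (h : (pancakeGraph n).Adj a b) :
    ∃ k, 2 ≤ k ∧ k ≤ n ∧ b = a * prefixRev n k := by
  obtain ⟨k, hk, hkn, h1, h2⟩ := h
  refine ⟨k, hk, hkn, Equiv.ext fun j => ?_⟩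
  rw [Equiv.Perm.mul_apply]
  by_cases hj : (j : ℕ) < k
  · exact (h1 _ _ (by rw [prefixRev_val_of_lt hkn hj]; omega)).symm
  · rw [prefixRev_of_le (not_lt.1 hj), h2 j (not_lt.1 hj)]

/-- The words that agree with `a` in all positions from `m` on. -/
def suffixClass (m : ℕ) (a : Equiv.Perm (Fin n)) : Set (Equiv.Perm (Fin n)) :=
  {b | ∀ i : Fin n, m ≤ (i : ℕ) → b i = a i}

theorem self_mem_suffixClass (m : ℕ) (a : Equiv.Perm (Fin n)) : a ∈ suffixClass m a :=
  fun _ _ => rfl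

theorem suffixClass_eq {m : ℕ} {a b : Equiv.Perm (Fin n)} (h : b ∈ suffixClass m a) :
    suffixClass m b = suffixClass m a := by
  ext c
  exact forall₂_congr fun i hi => by rw [h i hi]

theorem mul_prefixRev_mem {k m : ℕ} (hkm : k ≤ m) {a b : Equiv.Perm (Fin n)}
    (hb : b ∈ suffixClass m a) : b * prefixRev n k ∈ suffixClass m a := fun i hi => by
  rw [Equiv.Perm.mul_apply, prefixRev_of_le (hkm.trans hi), hb i hi]

theorem mem_suffixClass_iff {m : ℕ} (hm : m < n) {a b c : Equiv.Perm (Fin n)}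
    (hb : b ∈ suffixClass (m + 1) a) :
    c ∈ suffixClass m b ↔ c ∈ suffixClass (m + 1) a ∧ c ⟨m, hm⟩ = b ⟨m, hm⟩ := by
  constructor
  · intro h
    exact ⟨fun i hi => (h i (by omega)).trans (hb i hi), h _ le_rfl⟩
  · rintro ⟨h1, h2⟩ i hi
    rcases hi.eq_or_lt with h | h
    · have : i = ⟨m, hm⟩ := Fin.ext h.symm
      rw [this, h2]
    · rw [h1 i h, hb i h]

/-- Both ends of `e` lie in `C`. -/
def EdgeWithin {V : Type*} (C : Set V) (e : Sym2 V) : Prop := ∀ v ∈ e, v ∈ C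

open Classical in
/-- The number of faulty vertices and faulty edges inside `C`. -/
noncomputable def faultCount {V : Type*} (FV : Finset V) (FE : Finset (Sym2 V)) (C : Set V) : ℕ :=
  #{v ∈ FV | v ∈ C} + #{e ∈ FE | EdgeWithin C e}

/-- Every suffix class of level `m` with at most `m - 2` faults inside it keeps a fractional
perfect matching. -/
def FaultTolerant (n m : ℕ) : Prop :=
  ∀ (a : Equiv.Perm (Fin n)) (FV : Finset (Equiv.Perm (Fin n)))
    (FE : Finset (Sym2 (Equiv.Perm (Fin n)))),
    faultCount FV FE (suffixClass m a) ≤ m - 2 →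
      ((pancakeGraph n).deleteEdges FE).HasFractionalFactor
        ((suffixClass m a \ FV).indicator 1)

/-- The subclasses with last free symbol in `T` are disjoint, so their factors add. -/
theorem FaultTolerant.union {m : ℕ} (ih : FaultTolerant n m) (hm : m < n)
    {a : Equiv.Perm (Fin n)} {FV : Finset (Equiv.Perm (Fin n))}
    {FE : Finset (Sym2 (Equiv.Perm (Fin n)))} (T : Set (Fin n))
    (h : ∀ b ∈ suffixClass (m + 1) a, b ⟨m, hm⟩ ∈ T →
      faultCount FV FE (suffixClass m b) ≤ m - 2) :
    ((pancakeGraph n).deleteEdges FE).HasFractionalFactor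
      ({b | b ∈ suffixClass (m + 1) a ∧ b ⟨m, hm⟩ ∈ T ∧ b ∉ FV}.indicator 1) := by
  classical
  have key := HasFractionalFactor.sum (H := (pancakeGraph n).deleteEdges FE)
    (univ.filter (· ∈ T))
    (D := fun x => {b | b ∈ suffixClass (m + 1) a ∧ b ⟨m, hm⟩ = x ∧ b ∉ FV}.indicator 1)
    fun x hx => by
      by_cases hne : ∃ b ∈ suffixClass (m + 1) a, b ⟨m, hm⟩ = x
      · obtain ⟨b, hb, rfl⟩ := hne
        convert ih b FV FE (h b hb (mem_filter.1 hx).2) using 2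
        ext c
        simp only [Set.mem_ofPred_eq, Set.mem_sdiff, mem_suffixClass_iff hm hb, mem_coe]
        tauto
      · convert HasFractionalFactor.zero ((pancakeGraph n).deleteEdges FE) using 1
        refine Set.indicator_eq_zero'.2 ?_
        rw [Set.disjoint_right]
        rintro b ⟨hb, hbx, -⟩
        exact absurd ⟨b, hb, hbx⟩ hne
  convert key using 1
  ext b
  rw [Finset.sum_apply]
  simp only [Set.indicator_apply, Set.mem_ofPred_eq, Pi.one_apply]
  by_cases hb : b ∈ suffixClass (m + 1) a
  · by_cases hF : b ∈ FV
    · simp [hF]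
    · simp [hb, hF]
  · simp [hb]

/-- If all faults of a class lie in the subclass of `b₀`, then at most two fault-free vertices of
that subclass can be matched to other subclasses, which remain perfectly matched. -/
theorem FaultTolerant.reroute {m : ℕ} (hm4 : 4 ≤ m) (ih : FaultTolerant n m) (hm : m < n)
    {a b₀ : Equiv.Perm (Fin n)} (hb₀ : b₀ ∈ suffixClass (m + 1) a)
    {FE : Finset (Sym2 (Equiv.Perm (Fin n)))}
    (hFE : ∀ e ∈ FE, (∀ v ∈ e, v ∈ suffixClass (m + 1) a) → ∀ v ∈ e, v ∈ suffixClass m b₀)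
    (A : Finset (Equiv.Perm (Fin n))) (hA : #A ≤ 2) (hAsub : ∀ v ∈ A, v ∈ suffixClass m b₀) :
    ((pancakeGraph n).deleteEdges FE).HasFractionalFactor
      ((A : Set _).indicator 1 + (suffixClass (m + 1) a \ suffixClass m b₀).indicator 1) := by
  classical
  -- Reversing `m + 1` positions brings the first symbol to position `m`, so every word leaves its
  -- subclass.
  set r := prefixRev n (m + 1)
  have hrm : ∀ v, (v * r) ⟨m, hm⟩ = v ⟨0, by omega⟩ := fun v => by
    rw [Equiv.Perm.mul_apply]
    congr 1
    ext
    rw [prefixRev_val_of_lt hm (by simp)]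
    simp
  have hcross : ∀ v ∈ suffixClass m b₀,
      v ∈ suffixClass (m + 1) a ∧ v * r ∈ suffixClass (m + 1) a ∧ v * r ∉ suffixClass m b₀ := by
    intro v hv
    have hv' := (mem_suffixClass_iff hm hb₀).1 hv
    refine ⟨hv'.1, mul_prefixRev_mem le_rfl hv'.1, fun h => ?_⟩
    have h1 := ((mem_suffixClass_iff hm hb₀).1 h).2
    rw [hrm, ← hv'.2] at h1
    have := congrArg Fin.val (v.injective h1)
    simp at this
    omega
  -- The partners of `A` count as faulty vertices of the other subclasses: at most `2 ≤ m - 2`,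
  -- which is where `4 ≤ m` enters.
  have hU := ih.union hm (a := a) (FV := A.image (· * r)) (FE := FE) {b₀ ⟨m, hm⟩}ᶜ
    fun b hb hbm => by
      have h1 : ∀ v ∈ suffixClass m b, v ∉ suffixClass m b₀ := fun v hv hv' =>
        hbm (((mem_suffixClass_iff hm hb).1 hv).2.symm.trans
          ((mem_suffixClass_iff hm hb₀).1 hv').2)
      have h2 : {e ∈ FE | EdgeWithin (suffixClass m b) e} = ∅ := by
        refine filter_eq_empty_iff.2 fun e he hev => ?_
        have h3 := hFE e he fun v hv => ((mem_suffixClass_iff hm hb).1 (hev v hv)).1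
        exact h1 _ (hev _ e.out_fst_mem) (h3 _ e.out_fst_mem)
      rw [faultCount, h2, card_empty, add_zero]
      exact (card_filter_le _ _).trans (card_image_le.trans (hA.trans (by omega)))
  have hE := HasFractionalFactor.sum (H := (pancakeGraph n).deleteEdges FE) A
    (D := fun v => Pi.single v 1 + Pi.single (v * r) 1) fun v hv => by
      refine HasFractionalFactor.edge ?_
      refine (deleteEdges_adj).2 ⟨adj_mul_prefixRev (by omega) hm v, fun he => ?_⟩
      have hc := hcross v (hAsub v hv)
      exact hc.2.2 (hFE _ he (by simp [hc.1, hc.2.1]) (v * r) (by simp))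
  convert hE.add hU using 1
  rw [sum_add_distrib, add_assoc]
  have hind : ∀ B : Finset (Equiv.Perm (Fin n)),
      ∑ v ∈ B, (Pi.single v 1 : _ → ℝ) = (B : Set _).indicator 1 := fun B => by
    ext x
    rw [Finset.sum_apply]
    simp [Pi.single_apply, Set.indicator_apply]
  rw [hind]
  congr 1
  rw [← sum_image (g := (· * r)) (f := fun v => (Pi.single v 1 : _ → ℝ))
    (fun _ _ _ _ h => mul_right_cancel h), hind]
  ext v
  simp only [Pi.add_apply, Set.indicator_apply, Set.mem_sdiff, Set.mem_ofPred_eq, mem_coe,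
    Set.mem_compl_iff, Set.mem_singleton_iff, mem_suffixClass_iff hm hb₀, Pi.one_apply]
  by_cases hv : v ∈ A.image (· * r)
  · obtain ⟨u, hu, rfl⟩ := mem_image.1 hv
    have hc := hcross u (hAsub u hu)
    rw [mem_suffixClass_iff hm hb₀] at hc
    simp only [hv, hc.2.1, true_and] at hc ⊢
    simp only [hc.2, not_false_eq_true, not_true_eq_false, and_false, if_true, if_false, add_zero]
  · simp only [hv, not_false_eq_true, and_true, if_false, zero_add]
    congr 1
    simp only [eq_iff_iff]
    tauto

theorem indicator_sdiff_eq_add {α : Type*} {C C₀ F : Set α} (hsub : C₀ ⊆ C)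
    (hF : ∀ x ∈ F, x ∈ C → x ∈ C₀) :
    (C \ F).indicator (1 : α → ℝ) = (C₀ \ F).indicator 1 + (C \ C₀).indicator 1 := by
  classical
  ext x
  have h1 := @hsub x
  have h2 := hF x
  simp only [Pi.add_apply, Set.indicator_apply, Set.mem_sdiff]
  by_cases hx0 : x ∈ C₀
  · simp [hx0, h1 hx0]
  · by_cases hxc : x ∈ C
    · have hxF : x ∉ F := fun h => hx0 (h2 h hxc)
      simp [hx0, hxc, hxF]
    · simp [hx0, hxc]

theorem FaultTolerant.succ {m : ℕ} (hm4 : 4 ≤ m) (hm : m < n) (ih : FaultTolerant n m) :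
    FaultTolerant n (m + 1) := by
  classical
  intro a FV FE hF
  by_cases hall : ∀ b ∈ suffixClass (m + 1) a, faultCount FV FE (suffixClass m b) ≤ m - 2
  · convert ih.union hm (a := a) (FV := FV) (FE := FE) Set.univ fun b hb _ => hall b hb using 2
    ext b
    simp
  push Not at hall
  obtain ⟨b₀, hb₀, hb₀F⟩ := hall
  set c := suffixClass (m + 1) a with hc
  set c₀ := suffixClass m b₀ with hc₀
  have hsub : c₀ ⊆ c := fun v hv => ((mem_suffixClass_iff hm hb₀).1 hv).1
  -- The subclass `c₀` has at least `m - 1` faults and `c` at most `m - 1`, so all faults of `c` lie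
  -- in `c₀`.
  have hVs : {v ∈ FV | v ∈ c₀} ⊆ {v ∈ FV | v ∈ c} := monotone_filter_right _ fun v _ hv => hsub hv
  have hEs : {e ∈ FE | EdgeWithin c₀ e} ⊆ {e ∈ FE | EdgeWithin c e} :=
    monotone_filter_right _ fun e _ he v hv => hsub (he v hv)
  have hVc := card_le_card hVs
  have hEc := card_le_card hEs
  simp only [faultCount] at hF hb₀F
  have hVeq := eq_of_subset_of_card_le hVs (by omega)
  have hEeq := eq_of_subset_of_card_le hEs (by omega)
  have hFV : ∀ v ∈ FV, v ∈ c → v ∈ c₀ := fun v hv hvc =>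
    (mem_filter.1 (hVeq ▸ mem_filter.2 ⟨hv, hvc⟩ : v ∈ {v ∈ FV | v ∈ c₀})).2
  have hFE : ∀ e ∈ FE, (∀ v ∈ e, v ∈ c) → ∀ v ∈ e, v ∈ c₀ := fun e he hec =>
    (mem_filter.1 (hEeq ▸ mem_filter.2 ⟨he, hec⟩ : e ∈ {e ∈ FE | EdgeWithin c₀ e})).2
  have hR := ih.reroute hm4 hm hb₀ hFE
  have ihb := ih b₀
  rw [← hc, ← hc₀] at hR
  rw [← hc₀] at ihb
  by_cases hV0 : {v ∈ FV | v ∈ c₀}.Nonempty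
  · obtain ⟨u, hu⟩ := hV0
    have hu' := mem_filter.1 hu
    have h1 := ihb (FV.erase u) FE (by
      rw [faultCount, filter_erase, card_erase_of_mem hu]
      have := card_pos.2 ⟨u, hu⟩
      omega)
    obtain ⟨t, ht0, htd, hta, hts, h2⟩ := h1.delete_vertex u
    have hdu : (c₀ \ ((FV.erase u : Finset _) : Set _)).indicator (1 : Equiv.Perm (Fin n) → ℝ) u = 1 := by
      rw [Set.indicator_of_mem]
      · rfl
      · simp [hu'.2]
    -- The numbers `t w` sum to 1: this convex combination of reroutings repays each `w` its deficit
    -- and gives `c \ c₀` demand 1.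
    have h3 := HasFractionalFactor.sum (H := (pancakeGraph n).deleteEdges FE) univ
      (D := fun w => t w • (((({w} : Finset _) : Set _).indicator 1 : _ → ℝ) +
        (c \ c₀).indicator 1)) fun w _ => HasFractionalFactor.smul (ht0 w) fun htw =>
          hR {w} (by simp) fun v hv => by
            rw [mem_singleton.1 hv]
            by_contra hw
            have := htd w
            rw [Set.indicator_of_notMem fun h => hw h.1] at this
            exact htw (le_antisymm this (ht0 w))
    convert h2.add h3 using 1
    rw [hdu] at hts ⊢
    simp only [smul_add, sum_add_distrib]
    rw [← sum_smul, hts, one_smul]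
    have h4 : ∑ w, t w • (((({w} : Finset _) : Set _).indicator 1 : _ → ℝ)) = t := by
      ext x
      rw [Finset.sum_apply]
      simp [Pi.single_apply]
    rw [h4]
    rw [← add_assoc, sub_add_cancel, indicator_sdiff_eq_add hsub hFV]
    congr 1
    ext x
    rw [Pi.sub_apply]
    by_cases hxu : x = u
    · subst hxu
      simp [hu'.1, hu'.2]
    · simp [Set.indicator_apply, hxu]
  · rw [not_nonempty_iff_eq_empty] at hV0
    rw [hV0, card_empty] at hb₀F
    obtain ⟨e, he⟩ : {e ∈ FE | EdgeWithin c₀ e}.Nonempty := card_pos.1 (by omega)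
    have he' := mem_filter.1 he
    have h1 := ihb FV (FE.erase e) (by
      rw [faultCount, filter_erase, card_erase_of_mem he, hV0, card_empty]
      rw [hVeq] at hV0
      have := card_pos.2 ⟨e, he⟩
      omega)
    induction e with
    | _ u v =>
    obtain ⟨t, ht0, htu, htv, hta, h2⟩ := h1.delete_edge u v
    rw [deleteEdges_deleteEdges] at h2
    have hG : (((FE.erase s(u, v) : Finset _) : Set (Sym2 (Equiv.Perm (Fin n)))) ∪ {s(u, v)}) =
        (FE : Set (Sym2 (Equiv.Perm (Fin n)))) := by
      ext x
      simp only [coe_erase, Set.mem_union, Set.mem_sdiff, Set.mem_singleton_iff, mem_coe]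
      by_cases hx : x = s(u, v)
      · simp [hx, he'.1]
      · simp [hx]
    rw [hG] at h2
    have h3 := HasFractionalFactor.smul ht0 fun ht =>
      hR {u, v} card_le_two fun w hw => he'.2 w (by simpa using hw)
    have ht1 : t ≤ 1 := htu.trans (Set.indicator_le_self' (by simp) u)
    -- Rerouting both ends with weight `t` must be topped up to total weight 1 on `c \ c₀`.
    have h4 := HasFractionalFactor.smul (sub_nonneg.2 ht1) fun _ => hR ∅ (by simp) (by simp)
    convert (h2.add h3).add h4 using 1
    have h5 : t • ((({u, v} : Finset _) : Set _).indicator 1 : Equiv.Perm (Fin n) → ℝ) =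
        t • (Pi.single u 1 + Pi.single v 1) := by
      -- A member of `FE` may be a loop here; `u ≠ v` is known only when `t ≠ 0`.
      by_cases ht : t = 0
      · simp [ht]
      have huv := (hta ht).ne
      ext x
      by_cases hx : x = u <;> by_cases hx' : x = v <;> simp_all [Set.indicator_apply]
    rw [smul_add t (Set.indicator _ _), h5]
    rw [indicator_sdiff_eq_add hsub hFV, coe_empty, Set.indicator_empty', zero_add, sub_smul,
      one_smul]
    abel

end Pancake

/-! ### The base case: words on four symbols -/

namespace Pancake

open SimpleGraph

variable {n : ℕ}

/-- The position of a word on four symbols in the lexicographic order. -/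
def lexRank (x : Equiv.Perm (Fin 4)) : ℕ :=
  6 * x 0 + 2 * (x 1 - if x 0 < x 1 then 1 else 0) + if x 3 < x 2 then 1 else 0

/-- Move `x` along the edge whose reversal length is recorded in the ternary digits of `T`. -/
def tableMap (T : ℕ) (x : Equiv.Perm (Fin 4)) : Equiv.Perm (Fin 4) :=
  x * prefixRev 4 (T / 3 ^ lexRank x % 3 + 2)

/-- Encodes, for each word `b ≠ 1`, a perfect matching of the pancake graph of dimension four
without the vertices `1` and `b`. -/
def pairTable (b : Equiv.Perm (Fin 4)) : ℕ :=
  [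
    0, 22501609236, 532170, 63969023430, 784945656, 22085448732,
    0, 4271789190, 67119468942, 813643632, 66335002896, 20921238594,
    67119475512, 20921592942, 538740, 22085488584, 62762120676, 94956842142,
    66335062026, 813683484, 785004786, 63969377778, 4357887006, 63106498824].getD (lexRank b) 0

theorem tableMap_pairTable : ∀ b : Equiv.Perm (Fin 4), b ≠ 1 → ∀ x, x ≠ 1 → x ≠ b →
    tableMap (pairTable b) x ≠ 1 ∧ tableMap (pairTable b) x ≠ b ∧
      tableMap (pairTable b) (tableMap (pairTable b) x) = x := by
  decide +kernel

/-- Three permutations moving each word `x ≠ 1` along an edge that avoids `1`; no edge is used by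
all three of them. -/
def singleTable : Fin 3 → ℕ := ![67034444220, 115739133384, 74702384514]

theorem tableMap_singleTable_ne : ∀ i, ∀ x ≠ 1, tableMap (singleTable i) x ≠ 1 := by
  decide +kernel

theorem tableMap_singleTable_injOn : ∀ i, ∀ x ≠ 1, ∀ y ≠ 1,
    tableMap (singleTable i) x = tableMap (singleTable i) y → x = y := by
  decide +kernel

theorem singleTable_no_common_edge : ∀ x ≠ 1, ∀ y, tableMap (singleTable 0) x = y →
    ¬ ((tableMap (singleTable 1) x = y ∨ tableMap (singleTable 1) y = x) ∧
      (tableMap (singleTable 2) x = y ∨ tableMap (singleTable 2) y = x)) := by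
  decide +kernel

theorem prefixRev_four_injective : Function.Injective fun i : Fin 3 => prefixRev 4 (i + 2) := by
  decide +kernel

/-- A permutation of the first four positions, applied to `n ≥ 4` positions. -/
noncomputable def extendFour (hn : 4 ≤ n) : Equiv.Perm (Fin 4) →* Equiv.Perm (Fin n) :=
  Equiv.Perm.viaEmbeddingHom (Fin.castLEEmb hn)

theorem extendFour_injective (hn : 4 ≤ n) : Function.Injective (extendFour hn) :=
  Equiv.Perm.viaEmbeddingHom_injective _

theorem extendFour_castLE (hn : 4 ≤ n) (b : Equiv.Perm (Fin 4)) (i : Fin 4) :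
    extendFour hn b (Fin.castLE hn i) = Fin.castLE hn (b i) :=
  Equiv.Perm.viaEmbedding_apply b (Fin.castLEEmb hn) i

theorem extendFour_of_le (hn : 4 ≤ n) (b : Equiv.Perm (Fin 4)) {i : Fin n} (hi : 4 ≤ (i : ℕ)) :
    extendFour hn b i = i :=
  Equiv.Perm.viaEmbedding_apply_of_notMem b (Fin.castLEEmb hn) i (by
    rintro ⟨j, rfl⟩
    have := j.2
    simp at hi
    omega)

theorem extendFour_prefixRev (hn : 4 ≤ n) {k : ℕ} (hk : k ≤ 4) :
    extendFour hn (prefixRev 4 k) = prefixRev n k := by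
  ext i
  by_cases hi : 4 ≤ (i : ℕ)
  · rw [extendFour_of_le hn _ hi, prefixRev_of_le (hk.trans hi)]
  · obtain ⟨j, rfl⟩ : ∃ j : Fin 4, Fin.castLE hn j = i := ⟨⟨i, not_le.1 hi⟩, rfl⟩
    rw [extendFour_castLE]
    by_cases hj : (j : ℕ) < k
    · rw [prefixRev_val_of_lt (hk.trans hn) (by simpa using hj)]
      simp [prefixRev_val_of_lt hk hj]
    · rw [prefixRev_of_le (not_lt.1 hj), prefixRev_of_le (by simpa using hj)]

theorem exists_extendFour_eq (hn : 4 ≤ n) {σ : Equiv.Perm (Fin n)}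
    (hσ : ∀ i : Fin n, 4 ≤ (i : ℕ) → σ i = i) : ∃ b, extendFour hn b = σ := by
  have hlt : ∀ i : Fin 4, (σ (Fin.castLE hn i) : ℕ) < 4 := fun i => by
    by_contra h
    have h1 := σ.injective (hσ _ (not_lt.1 h))
    have := i.2
    rw [h1] at h
    simp at h
  have hinj : Function.Injective fun i : Fin 4 => (⟨σ (Fin.castLE hn i), hlt i⟩ : Fin 4) := by
    intro i j hij
    have h1 : σ (Fin.castLE hn i) = σ (Fin.castLE hn j) := Fin.ext (by simpa using hij)
    simpa using σ.injective h1
  refine ⟨Equiv.ofBijective _ (Finite.injective_iff_bijective.1 hinj), ?_⟩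
  ext i
  by_cases hi : 4 ≤ (i : ℕ)
  · rw [extendFour_of_le hn _ hi, hσ i hi]
  · obtain ⟨j, rfl⟩ : ∃ j : Fin 4, Fin.castLE hn j = i := ⟨⟨i, not_le.1 hi⟩, rfl⟩
    rw [extendFour_castLE]
    simp

theorem mem_suffixClass_four (hn : 4 ≤ n) {a c : Equiv.Perm (Fin n)} :
    c ∈ suffixClass 4 a ↔ ∃ b, a * extendFour hn b = c := by
  constructor
  · intro h
    obtain ⟨b, hb⟩ := exists_extendFour_eq hn (σ := a⁻¹ * c) fun i hi => by
      rw [Equiv.Perm.mul_apply, h i hi, ← Equiv.Perm.mul_apply, inv_mul_cancel, Equiv.Perm.one_apply]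
    exact ⟨b, by rw [hb, mul_inv_cancel_left]⟩
  · rintro ⟨b, rfl⟩ i hi
    rw [Equiv.Perm.mul_apply, extendFour_of_le hn b hi]

/-- Edges are right multiplications, so left multiplication by `a` carries a pattern on four symbols
to the class of `a`. -/
theorem factor_of_four (hn : 4 ≤ n) (a : Equiv.Perm (Fin n))
    {FE : Finset (Sym2 (Equiv.Perm (Fin n)))} (S : Finset (Equiv.Perm (Fin 4)))
    {p : Equiv.Perm (Fin 4) → Equiv.Perm (Fin 4)} (hp : Set.MapsTo p S S) (hinj : Set.InjOn p S)
    (hk : ∀ x, ∃ k, 2 ≤ k ∧ k ≤ 4 ∧ p x = x * prefixRev 4 k)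
    (hFE : ∀ x ∈ S, s(a * extendFour hn x, a * extendFour hn (p x)) ∉ FE) :
    ((pancakeGraph n).deleteEdges FE).HasFractionalFactor
      (((fun x => a * extendFour hn x) '' S).indicator 1) := by
  refine HasFractionalFactor.of_permutation
    ((mul_right_injective a).comp (extendFour_injective hn)) S hp hinj fun x hx => ?_
  refine deleteEdges_adj.2 ⟨?_, hFE x hx⟩
  obtain ⟨k, hk2, hk4, hpx⟩ := hk x
  rw [hpx]
  dsimp only [Function.comp_apply]
  rw [map_mul, extendFour_prefixRev hn hk4, ← mul_assoc]
  exact adj_mul_prefixRev hk2 (hk4.trans hn) _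

theorem tableMap_eq (T : ℕ) (x : Equiv.Perm (Fin 4)) :
    ∃ k, 2 ≤ k ∧ k ≤ 4 ∧ tableMap T x = x * prefixRev 4 k :=
  ⟨T / 3 ^ lexRank x % 3 + 2, by omega, by omega, rfl⟩

theorem faultTolerant_four (hn : 4 ≤ n) : FaultTolerant n 4 := by
  classical
  intro a FV FE hF
  by_cases hV : ∃ u ∈ FV, u ∈ suffixClass 4 a
  · obtain ⟨u, huF, hu⟩ := hV
    -- Recentring the class at the faulty vertex `u` makes it correspond to the word `1` of the
    -- tables.
    rw [← suffixClass_eq hu] at hF ⊢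
    clear hu a
    have hinj : Function.Injective fun x => u * extendFour hn x :=
      (mul_right_injective u).comp (extendFour_injective hn)
    have hmem : ∀ x, u * extendFour hn x ∈ suffixClass 4 u := fun x =>
      (mem_suffixClass_four hn).2 ⟨x, rfl⟩
    have hin : ∀ x y, s(u * extendFour hn x, u * extendFour hn y) ∈ FE →
        s(u * extendFour hn x, u * extendFour hn y) ∈
          {e ∈ FE | EdgeWithin (suffixClass 4 u) e} := fun x y h =>
      mem_filter.2 ⟨h, fun v hv => by
        rcases Sym2.mem_iff.1 hv with rfl | rfl <;> exact hmem _⟩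
    have huV : u ∈ {v ∈ FV | v ∈ suffixClass 4 u} :=
      mem_filter.2 ⟨huF, self_mem_suffixClass 4 u⟩
    simp only [faultCount] at hF
    by_cases hb : ∃ b, b ≠ 1 ∧ u * extendFour hn b ∈ FV
    · obtain ⟨b, hb1, hbF⟩ := hb
      have hne : u ≠ u * extendFour hn b := fun h =>
        hb1 (hinj (by simpa using h.symm))
      have hsub : {u, u * extendFour hn b} ⊆ {v ∈ FV | v ∈ suffixClass 4 u} := by
        intro v hv
        rcases mem_insert.1 hv with rfl | hv
        · exact huV
        · rw [mem_singleton.1 hv]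
          exact mem_filter.2 ⟨hbF, hmem b⟩
      have hc := card_le_card hsub
      rw [card_pair hne] at hc
      have hVeq := eq_of_subset_of_card_le hsub (by rw [card_pair hne]; omega)
      have hE : {e ∈ FE | EdgeWithin (suffixClass 4 u) e} = ∅ := card_eq_zero.1 (by omega)
      have ht := tableMap_pairTable b hb1
      convert factor_of_four hn u (FE := FE) (univ.filter fun x => x ≠ 1 ∧ x ≠ b)
        (p := tableMap (pairTable b))
        (fun x hx => by
          simp only [coe_filter, mem_univ, true_and, Set.mem_ofPred_eq] at hx ⊢
          exact ⟨(ht x hx.1 hx.2).1, (ht x hx.1 hx.2).2.1⟩)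
        (fun x hx y hy hxy => by
          simp only [coe_filter, mem_univ, true_and, Set.mem_ofPred_eq] at hx hy
          rw [← (ht x hx.1 hx.2).2.2, hxy, (ht y hy.1 hy.2).2.2])
        (tableMap_eq _)
        (fun x _ h => by
          have := hin _ _ h
          simp [hE] at this) using 2
      ext v
      simp only [Set.mem_sdiff, mem_suffixClass_four hn, mem_coe, coe_filter, mem_univ, true_and,
        Set.mem_image, Set.mem_ofPred_eq]
      constructor
      · rintro ⟨⟨x, rfl⟩, hx⟩
        refine ⟨x, ⟨?_, ?_⟩, rfl⟩
        · rintro rfl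
          exact hx (by simpa using huF)
        · rintro rfl
          exact hx hbF
      · rintro ⟨x, ⟨hx1, hxb⟩, rfl⟩
        refine ⟨⟨x, rfl⟩, fun h => ?_⟩
        have h1 : u * extendFour hn x ∈ {v ∈ FV | v ∈ suffixClass 4 u} :=
          mem_filter.2 ⟨h, hmem x⟩
        rw [← hVeq, mem_insert, mem_singleton] at h1
        rcases h1 with h1 | h1
        · exact hx1 (hinj (by simpa using h1))
        · exact hxb (hinj h1)
    · push Not at hb
      have hE : #{e ∈ FE | EdgeWithin (suffixClass 4 u) e} ≤ 1 := by
        have := card_pos.2 ⟨u, huV⟩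
        omega
      -- If all three permutations met a fault, the only faulty edge would be common to all three.
      obtain ⟨i, hi⟩ : ∃ i, ∀ x ≠ 1,
          s(u * extendFour hn x, u * extendFour hn (tableMap (singleTable i) x)) ∉ FE := by
        by_contra! hcon
        choose x hx1 hx using hcon
        have heq : ∀ i, tableMap (singleTable i) (x 0) = tableMap (singleTable 0) (x 0) ∨
            tableMap (singleTable i) (tableMap (singleTable 0) (x 0)) = x 0 := fun i => by
          have h1 := card_le_one.1 hE _ (hin _ _ (hx 0)) _ (hin _ _ (hx i))
          rcases Sym2.eq_iff.1 h1 with ⟨h2, h3⟩ | ⟨h2, h3⟩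
          · left
            rw [hinj h3, hinj h2]
          · right
            rw [hinj h3, hinj h2]
        exact singleTable_no_common_edge (x 0) (hx1 0) _ rfl ⟨heq 1, heq 2⟩
      convert factor_of_four hn u (FE := FE) (univ.filter fun x => x ≠ 1)
        (p := tableMap (singleTable i))
        (fun x hx => by
          simp only [coe_filter, mem_univ, true_and, Set.mem_ofPred_eq] at hx ⊢
          exact tableMap_singleTable_ne i x hx)
        (fun x hx y hy hxy => by
          simp only [coe_filter, mem_univ, true_and, Set.mem_ofPred_eq] at hx hy
          exact tableMap_singleTable_injOn i x hx y hy hxy)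
        (tableMap_eq _)
        (fun x hx => hi x (mem_filter.1 hx).2) using 2
      ext v
      simp only [Set.mem_sdiff, mem_suffixClass_four hn, mem_coe, coe_filter, mem_univ, true_and,
        Set.mem_image, Set.mem_ofPred_eq]
      constructor
      · rintro ⟨⟨x, rfl⟩, hx⟩
        refine ⟨x, ?_, rfl⟩
        rintro rfl
        exact hx (by simpa using huF)
      · rintro ⟨x, hx1, rfl⟩
        exact ⟨⟨x, rfl⟩, hb x hx1⟩
  · push Not at hV
    have hinj : Function.Injective fun x => a * extendFour hn x :=
      (mul_right_injective a).comp (extendFour_injective hn)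
    have hmem : ∀ x, a * extendFour hn x ∈ suffixClass 4 a := fun x =>
      (mem_suffixClass_four hn).2 ⟨x, rfl⟩
    -- The reversals of lengths 2, 3 and 4 give three edge-disjoint perfect matchings, and at most
    -- two edges are faulty.
    obtain ⟨i, hi⟩ : ∃ i : Fin 3, ∀ x,
        s(a * extendFour hn x, a * extendFour hn (x * prefixRev 4 (i + 2))) ∉ FE := by
      by_contra! hcon
      choose x hx using hcon
      have hinj' : Function.Injective fun i : Fin 3 =>
          s(a * extendFour hn (x i), a * extendFour hn (x i * prefixRev 4 (i + 2))) := by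
        intro i j hij
        apply prefixRev_four_injective
        rcases Sym2.eq_iff.1 hij with ⟨h1, h2⟩ | ⟨h1, h2⟩
        · have h1 := hinj h1
          have h2 := hinj h2
          rw [h1] at h2
          exact mul_left_cancel h2
        · have h1 := hinj h1
          have h2 := hinj h2
          rw [h1, mul_assoc, mul_eq_left] at h2
          exact mul_left_cancel (h2.trans (prefixRev_mul_self 4 _).symm) |> fun h => by
            simpa using h
      have hc := card_le_card (s := univ.image fun i : Fin 3 =>
          s(a * extendFour hn (x i), a * extendFour hn (x i * prefixRev 4 (i + 2))))
        (t := {e ∈ FE | EdgeWithin (suffixClass 4 a) e}) (by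
          intro e he
          obtain ⟨i, -, rfl⟩ := mem_image.1 he
          exact mem_filter.2 ⟨hx i, fun v hv => by
            rcases Sym2.mem_iff.1 hv with rfl | rfl <;> exact hmem _⟩)
      rw [card_image_of_injective _ hinj', card_univ, Fintype.card_fin] at hc
      simp only [faultCount] at hF
      omega
    convert factor_of_four hn a (FE := FE) univ (p := fun x => x * prefixRev 4 (i + 2))
      (fun x _ => by simp) (fun x _ y _ hxy => mul_right_cancel hxy)
      (fun x => ⟨i + 2, by omega, by omega, rfl⟩) (fun x _ => hi x) using 2
    ext v
    simp only [Set.mem_sdiff, mem_coe, coe_univ, Set.image_univ, Set.mem_range,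
      ← mem_suffixClass_four hn, and_iff_left_iff_imp]
    exact fun hv hvF => hV v hvF hv

/-! ### The whole graph and the two bounds -/

theorem faultTolerant {m : ℕ} (hm : 4 ≤ m) (hmn : m ≤ n) : FaultTolerant n m := by
  induction m, hm using Nat.le_induction with
  | base => exact faultTolerant_four hmn
  | succ m hm ih => exact (ih (by omega)).succ hm hmn

theorem factor_of_card_le (hn : 4 ≤ n) (FV : Finset (Equiv.Perm (Fin n)))
    (FE : Finset (Sym2 (Equiv.Perm (Fin n)))) (h : #FV + #FE ≤ n - 2) :
    ((pancakeGraph n).deleteEdges FE).HasFractionalFactor ({v | v ∉ FV}.indicator 1) := by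
  classical
  have hclass : suffixClass n (1 : Equiv.Perm (Fin n)) = Set.univ :=
    Set.eq_univ_of_forall fun b i hi => absurd i.2 (not_lt.2 hi)
  convert faultTolerant hn le_rfl 1 FV FE (le_trans (Nat.add_le_add (card_filter_le _ _)
    (card_filter_le _ _)) h) using 2
  rw [hclass]
  ext v
  simp

theorem card_incidenceFinset_le [DecidableRel (pancakeGraph n).Adj] (a : Equiv.Perm (Fin n)) :
    #((pancakeGraph n).incidenceFinset a) ≤ n - 1 := by
  rw [card_incidenceFinset_eq_degree, ← card_neighborFinset_eq_degree]
  have hsub : (pancakeGraph n).neighborFinset a ⊆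
      (Icc 2 n).image fun k => a * prefixRev n k := fun b hb => by
    obtain ⟨k, hk, hkn, rfl⟩ := mul_prefixRev_of_adj ((mem_neighborFinset _ _ _).1 hb)
    exact mem_image.2 ⟨k, mem_Icc.2 ⟨hk, hkn⟩, rfl⟩
  refine (card_le_card hsub).trans (card_image_le.trans ?_)
  rw [Nat.card_Icc]
  omega

end Pancake

namespace SimpleGraph

theorem HasFractionalFactor.not_isFSMPSet {V : Type*} [Fintype V] {G : SimpleGraph V}
    {FV : Finset V} {FE : Finset (Sym2 V)}
    (h : (G.deleteEdges FE).HasFractionalFactor ({v | v ∉ FV}.indicator 1)) :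
    ¬ G.IsFSMPSet FV FE := fun hF =>
  hF.2 (@hasFractionalPerfectMatching _ (_) _ (@induce _ _ _ _ (_) h))

theorem not_hasFractionalPerfectMatching_of_isolated {V : Type*} [Fintype V]
    {G : SimpleGraph V} {v : V} (hv : ∀ w, ¬ G.Adj v w) : ¬ G.HasFractionalPerfectMatching := by
  classical
  rintro ⟨f, -, hf⟩
  have h := hf v
  rw [sum_eq_zero] at h
  · exact zero_ne_one h
  · intro e he
    obtain ⟨he, hve⟩ := (mem_incidenceFinset _ _ _).1 he
    obtain ⟨w, rfl⟩ := hve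
    exact absurd he (hv w)

end SimpleGraph

open SimpleGraph Pancake in
theorem theorem4p36 (n : ℕ) (hn : 4 ≤ n) :
    (pancakeGraph n).fsmp = (pancakeGraph n).fmp ∧ (pancakeGraph n).fmp = n - 1 := by
  classical
  set F := (pancakeGraph n).incidenceFinset 1
  have hFsub : (F : Set (Sym2 (Equiv.Perm (Fin n)))) ⊆ (pancakeGraph n).edgeSet := fun e he =>
    ((mem_incidenceFinset _ _ _).1 he).1
  have hFcard : #F ≤ n - 1 := card_incidenceFinset_le 1
  have hiso : ∀ w, ¬ ((pancakeGraph n).deleteEdges F).Adj 1 w := fun w hw => by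
    rw [deleteEdges_adj] at hw
    exact hw.2 ((mem_incidenceFinset _ _ _).2 ⟨hw.1, Sym2.mem_mk_left _ _⟩)
  have hFMP : (pancakeGraph n).IsFMPSet F :=
    ⟨hFsub, not_hasFractionalPerfectMatching_of_isolated hiso⟩
  have hFSMP : (pancakeGraph n).IsFSMPSet ∅ F :=
    ⟨hFsub, not_hasFractionalPerfectMatching_of_isolated
      (v := ⟨1, by simp⟩) fun w hw => hiso w hw⟩
  have hfmp : (pancakeGraph n).fmp = n - 1 := by
    -- Since `sInf ∅ = 0` in `ℕ`, the lower bound also needs `F` as a witness of nonemptiness.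
    refine le_antisymm (le_trans (Nat.sInf_le ⟨F, hFMP, rfl⟩) hFcard)
      (le_csInf ⟨_, F, hFMP, rfl⟩ ?_)
    rintro _ ⟨F', hF', rfl⟩
    by_contra! hlt
    have h := factor_of_card_le hn ∅ F' (by rw [card_empty]; omega)
    simp only [notMem_empty, not_false_eq_true, Set.ofPred_true, Set.indicator_univ] at h
    exact hF'.2 h.hasFractionalPerfectMatching
  have hfsmp : (pancakeGraph n).fsmp = n - 1 := by
    refine le_antisymm (le_trans (Nat.sInf_le ⟨∅, F, hFSMP, rfl⟩) (by simpa using hFcard))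
      (le_csInf ⟨_, ∅, F, hFSMP, rfl⟩ ?_)
    rintro _ ⟨FV, FE, hF', rfl⟩
    by_contra! hlt
    exact (factor_of_card_le hn FV FE (by omega)).not_isFSMPSet hF'
  exact ⟨hfsmp.trans hfmp.symm, hfmp⟩
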